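/- Let $k$ be a field and let $\mathcal C$ be a skeletally small, Hom-finite, Krull-Schmidt, triangulated $k$-category with suspension functor $\Sigma$ and with a Serre duality, i.e. an autoequivalence $\nu\colon\mathcal C\to\mathcal C$ together with $k$-linear isomorphisms $\operatorname{Hom}_{\mathcal C}(X,Y)\simeq \operatorname{Hom}_k(\operatorname{Hom}_{\mathcal C}(Y,\nu X),k)$ natural in $X$ and $Y$. Let $T$ be a rigid object of $\mathcal C$, i.e. $\operatorname{Hom}_{\mathcal C}(T,\Sigma T)=0$. Let $\mathcal X_T$ be the class of objects $X$ of $\mathcal C$ with $\operatorname{Hom}_{\mathcal C}(T,X)=0$, and let $\mathcal C/\mathcal X_T$ be the category with the same objects as $\mathcal C$ whose morphisms are those of $\mathcal C$ modulo the morphisms that factor through an object of $\mathcal X_T$. Then the category $\mathcal C/\mathcal X_T$ is integral. That is, it is preabelian (an additive category in which every morphism has a kernel and a cokernel), and for all commutative squares $$\begin{array}{ccc} A & \xrightarrow{\;a\;} & B\\ {\scriptstyle b}\downarrow & & \downarrow{\scriptstyle c}\\ C & \xrightarrow{\;d\;} & D\end{array}$$ in $\mathcal C/\mathcal X_T$: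 if the square is a pullback and $d$ is an epimorphism, then $a$ is an epimorphism; and if the square is a pushout and $a$ is a monomorphism, then $d$ is a monomorphism. -/

import Mathlib

open CategoryTheory CategoryTheory.Limits CategoryTheory.Pretriangulated

universe v u w

/-- A Krull-Schmidt category: every object is a finite direct sum of objects with local
endomorphism rings. -/
def IsKrullSchmidt (C : Type u) [Category.{v} C] [Preadditive C] [HasFiniteBiproducts C] : Prop :=
  ∀ X : C, ∃ (n : ℕ) (Y : Fin n → C),
    (∀ i, IsLocalRing (End (Y i))) ∧ Nonempty (X ≅ ⨁ Y)

/-- A Serre duality on a `k`-linear category: an autoequivalence `ν` together with `k`-linear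
isomorphisms `Hom(X, Y) ≃ D Hom(Y, ν X)`, natural in `X` and `Y`, where `D = Hom_k(-, k)`. -/
structure SerreDuality (k : Type w) [Field k] (C : Type u) [Category.{v} C] [Preadditive C]
    [Linear k C] where
  /-- the autoequivalence -/
  ν : C ≌ C
  /-- the duality isomorphism -/
  iso (X Y : C) : (X ⟶ Y) ≃ₗ[k] Module.Dual k (Y ⟶ ν.functor.obj X)
  /-- naturality in the first variable -/
  naturality_left {X' X Y : C} (f : X' ⟶ X) (g : X ⟶ Y) (h : Y ⟶ ν.functor.obj X') :
    iso X' Y (f ≫ g) h = iso X Y g (h ≫ ν.functor.map f)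
  /-- naturality in the second variable -/
  naturality_right {X Y Y' : C} (g : X ⟶ Y) (e : Y ⟶ Y') (h : Y' ⟶ ν.functor.obj X) :
    iso X Y' (g ≫ e) h = iso X Y g (e ≫ h)

/-- `T` is rigid: `Ext¹(T, T) = Hom(T, ΣT) = 0`. -/
def IsRigidObject {C : Type u} [Category.{v} C] [Preadditive C] [HasShift C ℤ] (T : C) : Prop :=
  ∀ f : T ⟶ T⟦(1 : ℤ)⟧, f = 0

section FactorCategory

variable {C : Type u} [Category.{v} C] [Preadditive C]

/-- The class `X_T` of the objects `X` with `Hom(T, X) = 0`. -/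
def homKernel (T : C) : ObjectProperty C := fun X => ∀ f : T ⟶ X, f = 0

/-- The morphism `f` factors through an object of `X_T`. -/
def FactorsThroughHomKernel (T : C) {X Y : C} (f : X ⟶ Y) : Prop :=
  ∃ (U : C) (_ : homKernel T U) (a : X ⟶ U) (b : U ⟶ Y), f = a ≫ b

/-- Two parallel morphisms are identified when their difference factors through `X_T`. -/
def factorRel (T : C) : HomRel C := fun _ _ f g => FactorsThroughHomKernel T (f - g)

lemma FactorsThroughHomKernel.add [HasBinaryBiproducts C] {T X Y : C} {f g : X ⟶ Y}
    (hf : FactorsThroughHomKernel T f) (hg : FactorsThroughHomKernel T g) :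
    FactorsThroughHomKernel T (f + g) := by
  obtain ⟨U, hU, a, b, rfl⟩ := hf
  obtain ⟨V, hV, c, d, rfl⟩ := hg
  refine ⟨U ⊞ V, ?_, biprod.lift a c, biprod.desc b d, by simp⟩
  intro t
  apply biprod.hom_ext
  · rw [hU (t ≫ biprod.fst), zero_comp]
  · rw [hV (t ≫ biprod.snd), zero_comp]

lemma FactorsThroughHomKernel.zero [HasZeroObject C] (T X Y : C) :
    FactorsThroughHomKernel T (0 : X ⟶ Y) :=
  ⟨(HasZeroObject.zero' C).zero, fun _ => (isZero_zero C).eq_of_tgt _ _, 0, 0, by simp⟩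

variable [HasZeroObject C] [HasBinaryBiproducts C]

instance factorRel_congruence (T : C) : Congruence (factorRel T) where
  equivalence :=
    { refl := fun f => by
        simpa [factorRel] using FactorsThroughHomKernel.zero T _ _
      symm := by
        rintro f g ⟨U, hU, a, b, h⟩
        exact ⟨U, hU, -a, b, by rw [Preadditive.neg_comp, ← h, neg_sub]⟩
      trans := by
        intro f g h h₁ h₂
        have := FactorsThroughHomKernel.add h₁ h₂
        rwa [sub_add_sub_cancel] at this }
  comp_left := by
    rintro X Y Z f g g' ⟨U, hU, a, b, h⟩
    exact ⟨U, hU, f ≫ a, b, by rw [← Preadditive.comp_sub, h, Category.assoc]⟩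
  comp_right := by
    rintro X Y Z f f' g ⟨U, hU, a, b, h⟩
    exact ⟨U, hU, a, b ≫ g, by rw [← Preadditive.sub_comp, h, Category.assoc]⟩

lemma factorRel_add (T : C) ⦃X Y : C⦄ (f₁ f₂ g₁ g₂ : X ⟶ Y)
    (hf : factorRel T f₁ f₂) (hg : factorRel T g₁ g₂) :
    factorRel T (f₁ + g₁) (f₂ + g₂) := by
  have := FactorsThroughHomKernel.add hf hg
  rwa [sub_add_sub_comm] at this

/-- The factor category `C / X_T`: the objects are those of `C`, and the morphisms are those of `C`
modulo the morphisms factoring through `X_T`. -/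
abbrev FactorCategory (T : C) := Quotient (factorRel T)

/-- The additive structure on the morphisms of `C / X_T` induced by that of `C`. -/
instance factorCategoryPreadditive (T : C) : Preadditive (FactorCategory T) :=
  Quotient.preadditive (factorRel T) (factorRel_add T)

end FactorCategory

section Integral

variable (A : Type u) [Category.{v} A]

/-- A preabelian category: an additive category in which every morphism has a kernel and a
cokernel. -/
structure IsPreabelian [Preadditive A] : Prop where
  hasFiniteBiproducts : HasFiniteBiproducts A
  hasKernels : HasKernels A
  hasCokernels : HasCokernels A

/-- In every pullback square, the base change `a` of an epimorphism `d` is an epimorphism. -/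
def PullbacksPreserveEpi : Prop :=
  ∀ ⦃P B X D : A⦄ (a : P ⟶ B) (b : P ⟶ X) (c : B ⟶ D) (d : X ⟶ D),
    IsPullback a b c d → Epi d → Epi a

/-- In every pushout square, the cobase change `d` of a monomorphism `a` is a monomorphism. -/
def PushoutsPreserveMono : Prop :=
  ∀ ⦃P B X D : A⦄ (a : P ⟶ B) (b : P ⟶ X) (c : B ⟶ D) (d : X ⟶ D),
    IsPushout a b c d → Mono a → Mono d

/-- An integral category: a preabelian category which is left integral and right integral. -/
structure IsIntegralCategory [Preadditive A] : Prop where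
  preabelian : IsPreabelian A
  leftIntegral : PullbacksPreserveEpi A
  rightIntegral : PushoutsPreserveMono A

end Integral

/-! Everything in `C / X_T` can be tested on maps from `T` or on maps to `νT`. If `f : X ⟶ Y` kills
all maps from `T`, it factors through the cone of a right approximation `Tⁿ ⟶ X`, and rigidity puts
that cone in `X_T`. Serre duality turns this test into the dual one: `f` kills all maps to `νT`.
Hence monomorphisms are detected by `Hom(T, -)` and epimorphisms by `Hom(-, νT)`.

A kernel of `f` is the fibre of `X ⟶ Y ⟶ (νT)ⁿ`, a cokernel the cone of `Tⁿ ⟶ X ⟶ Y`. Being parts of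
triangles in `C`, they satisfy an additional exactness at `νT`, respectively `T`; applied to `(c,
-d)` and `(a, -b)`, it yields integrality. -/

section Approximation

variable (k : Type w) [Field k] {C : Type u} [Category.{v} C] [Preadditive C] [Linear k C]
  [HasFiniteBiproducts C]

/-- A right approximation of `X` by a finite direct sum of copies of `T`. -/
lemma exists_right_approximation (T X : C) [Module.Finite k (T ⟶ X)] :
    ∃ (n : ℕ) (p : (⨁ fun _ : Fin n => T) ⟶ X), ∀ t : T ⟶ X, ∃ t', t' ≫ p = t := by
  let b := Module.finBasis k (T ⟶ X)
  refine ⟨_, biproduct.desc b, fun t => ⟨biproduct.lift fun i => b.repr t i • 𝟙 T, ?_⟩⟩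
  simp [biproduct.lift_desc, b.sum_repr]

/-- A left approximation of `X` by a finite direct sum of copies of `S`. -/
lemma exists_left_approximation (S X : C) [Module.Finite k (X ⟶ S)] :
    ∃ (n : ℕ) (j : X ⟶ ⨁ fun _ : Fin n => S), ∀ s : X ⟶ S, ∃ s', j ≫ s' = s := by
  let b := Module.finBasis k (X ⟶ S)
  refine ⟨_, biproduct.lift b, fun s => ⟨biproduct.desc fun i => b.repr s i • 𝟙 S, ?_⟩⟩
  simp [biproduct.lift_desc, b.sum_repr]

end Approximation

/-! ### Testing by maps from `T` versus maps to `νT`. -/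

namespace SerreDuality

variable {k : Type w} [Field k] {C : Type u} [Category.{v} C] [Preadditive C] [Linear k C]
  (D : SerreDuality k C) (T : C)

/-- Naturality identifies `Hom(T, f)` with the transpose of `Hom(f, νT)`, so one vanishes exactly
when the other does. -/
lemma forall_comp_eq_zero_iff {X Y : C} (f : X ⟶ Y) :
    (∀ t : T ⟶ X, t ≫ f = 0) ↔ ∀ s : Y ⟶ D.ν.functor.obj T, f ≫ s = 0 := by
  constructor
  · intro h s
    rw [← Module.forall_dual_apply_eq_zero_iff k]
    intro φ
    obtain ⟨t, rfl⟩ := (D.iso T X).surjective φ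
    simpa [h] using (D.naturality_right t f s).symm
  · intro h t
    apply (D.iso T Y).injective
    ext s
    rw [D.naturality_right, h, map_zero, map_zero, LinearMap.zero_apply]

/-- Used with `Y = ΣT`, where rigidity gives `Hom(ΣT, νT) = 0`. -/
lemma eq_zero_of_forall_eq_zero {Y : C} (h : ∀ t : T ⟶ Y, t = 0)
    (s : Y ⟶ D.ν.functor.obj T) : s = 0 := by
  simpa using (D.forall_comp_eq_zero_iff T (𝟙 Y)).1 (by simpa using h) s

end SerreDuality

/-! ### Long exact sequences of a distinguished triangle. -/

section Exactness

variable {C : Type u} [Category.{v} C] [Preadditive C] [HasZeroObject C] [HasShift C ℤ]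
  [∀ n : ℤ, (shiftFunctor C n).Additive] [Pretriangulated C]
  {X Y Z : C} {f : X ⟶ Y} {g : Y ⟶ Z} {h : Z ⟶ X⟦(1 : ℤ)⟧}

lemma distTriang_comp_eq_zero (hd : Triangle.mk f g h ∈ distTriang C) : f ≫ g = 0 :=
  comp_distTriang_mor_zero₁₂ _ hd

lemma distTriang_exists_comp_mor₁ (hd : Triangle.mk f g h ∈ distTriang C) {W : C} (w : W ⟶ Y)
    (hw : w ≫ g = 0) : ∃ l : W ⟶ X, w = l ≫ f :=
  Triangle.coyoneda_exact₂ _ hd w hw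

lemma distTriang_exists_comp_mor₂ (hd : Triangle.mk f g h ∈ distTriang C) {W : C} (w : W ⟶ Z)
    (hw : w ≫ h = 0) : ∃ l : W ⟶ Y, w = l ≫ g :=
  Triangle.coyoneda_exact₃ _ hd w hw

lemma distTriang_exists_comp_mor₃ (hd : Triangle.mk f g h ∈ distTriang C) {W : C}
    (w : W ⟶ X⟦(1 : ℤ)⟧) (hw : w ≫ f⟦(1 : ℤ)⟧' = 0) : ∃ l : W ⟶ Z, w = l ≫ h :=
  Triangle.coyoneda_exact₁ _ hd w hw

lemma distTriang_exists_mor₂_comp (hd : Triangle.mk f g h ∈ distTriang C) {W : C} (w : Y ⟶ W)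
    (hw : f ≫ w = 0) : ∃ l : Z ⟶ W, w = g ≫ l :=
  Triangle.yoneda_exact₂ _ hd w hw

lemma distTriang_exists_mor₃_comp (hd : Triangle.mk f g h ∈ distTriang C) {W : C} (w : Z ⟶ W)
    (hw : g ≫ w = 0) : ∃ l : X⟦(1 : ℤ)⟧ ⟶ W, w = h ≫ l :=
  Triangle.yoneda_exact₃ _ hd w hw

end Exactness

/-! ### The factor category of a rigid object. -/

section RigidQuotient

variable {k : Type w} [Field k] {C : Type u} [Category.{v} C]
  [Preadditive C] [Linear k C] [HasZeroObject C] [HasShift C ℤ]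
  [∀ n : ℤ, (shiftFunctor C n).Additive] [Pretriangulated C]

/-- The projection functor onto `C / X_T`. -/
abbrev toFactorCategory (T : C) : C ⥤ FactorCategory T := Quotient.functor (factorRel T)

instance toFactorCategory_additive (T : C) : (toFactorCategory T).Additive :=
  Quotient.functor_additive _ (factorRel_add T)

lemma toFactorCategory_map_eq_zero_iff_factors (T : C) {X Y : C} (f : X ⟶ Y) :
    (toFactorCategory T).map f = 0 ↔ FactorsThroughHomKernel T f := by
  refine (Quotient.functor_map_eq_iff (factorRel T) f 0).trans ?_
  simp [factorRel]

/-- For a rigid object `T`, the functor `Hom(T, -)` is faithful on `C / X_T`. -/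
lemma toFactorCategory_map_eq_zero_iff (k : Type w) [Field k] [Linear k C]
    (hfin : ∀ X Y : C, Module.Finite k (X ⟶ Y)) {T : C} (hT : IsRigidObject T)
    {X Y : C} (f : X ⟶ Y) :
    (toFactorCategory T).map f = 0 ↔ ∀ t : T ⟶ X, t ≫ f = 0 := by
  rw [toFactorCategory_map_eq_zero_iff_factors]
  constructor
  · rintro ⟨U, hU, a, b, rfl⟩ t
    rw [← Category.assoc, hU (t ≫ a), zero_comp]
  · intro h
    obtain ⟨n, p, hp⟩ := exists_right_approximation k T X
    obtain ⟨U, q, r, hd⟩ := distinguished_cocone_triangle p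
    have hpf : p ≫ f = 0 := by
      apply biproduct.hom_ext'
      intro i
      rw [← Category.assoc, h, comp_zero]
    obtain ⟨g, hg⟩ := distTriang_exists_mor₂_comp hd f hpf
    refine ⟨U, fun u => ?_, q, g, hg⟩
    -- `Σ(Tⁿ) ≅ (ΣT)ⁿ`, so the components are maps `T ⟶ ΣT`. Thus `u` lifts along `q` to a map from
    -- `T`, which factors through `p`.
    have hur : u ≫ r = 0 := by
      let e := (shiftFunctor C (1 : ℤ)).mapBiproduct (fun _ : Fin n => T)
      rw [← cancel_mono e.hom, zero_comp]
      apply biproduct.hom_ext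
      intro i
      rw [zero_comp]
      exact hT _
    obtain ⟨x, hx⟩ := distTriang_exists_comp_mor₂ hd u hur
    obtain ⟨x', rfl⟩ := hp x
    have hpq : p ≫ q = 0 := distTriang_comp_eq_zero hd
    rw [hx, Category.assoc, hpq, comp_zero]


/-- After suspension, the obstruction to injectivity of `Hom(T, i)` lies in `Hom(ΣT, (νT)ⁿ)`, which
vanishes by rigidity and duality. -/
lemma SerreDuality.eq_zero_of_isRigidObject_of_comp {V Z : C} {n : ℕ}
    (D : SerreDuality k C) {T : C} (hT : IsRigidObject T)
    {i : V ⟶ Z} {q : Z ⟶ ⨁ fun _ : Fin n => D.ν.functor.obj T}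
    {r : (⨁ fun _ : Fin n => D.ν.functor.obj T) ⟶ V⟦(1 : ℤ)⟧}
    (hd : Triangle.mk i q r ∈ distTriang C) (t : T ⟶ V) (ht : t ≫ i = 0) : t = 0 := by
  apply (shiftFunctor C (1 : ℤ)).map_injective
  obtain ⟨g, hg⟩ := distTriang_exists_comp_mor₃ hd (t⟦(1 : ℤ)⟧')
    (by rw [← Functor.map_comp, ht, Functor.map_zero])
  have hg0 : g = 0 := by
    apply biproduct.hom_ext
    intro j
    rw [zero_comp]
    exact D.eq_zero_of_forall_eq_zero T hT _
  rw [hg, hg0, zero_comp, Functor.map_zero]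

lemma toFactorCategory_map_eq_zero_iff' (D : SerreDuality k C)
    (hfin : ∀ X Y : C, Module.Finite k (X ⟶ Y)) {T : C} (hT : IsRigidObject T)
    {X Y : C} (f : X ⟶ Y) :
    (toFactorCategory T).map f = 0 ↔ ∀ s : Y ⟶ D.ν.functor.obj T, f ≫ s = 0 := by
  rw [toFactorCategory_map_eq_zero_iff k hfin hT, D.forall_comp_eq_zero_iff]

lemma mono_toFactorCategory_map (hfin : ∀ X Y : C, Module.Finite k (X ⟶ Y)) {T : C}
    (hT : IsRigidObject T) {X Y : C} (f : X ⟶ Y) (hf : ∀ t : T ⟶ X, t ≫ f = 0 → t = 0) :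
    Mono ((toFactorCategory T).map f) := by
  refine Preadditive.mono_of_cancel_zero _ fun {W} g hg => ?_
  obtain ⟨W⟩ := W
  obtain ⟨g, rfl⟩ := (toFactorCategory T).map_surjective g
  rw [← Functor.map_comp, toFactorCategory_map_eq_zero_iff k hfin hT] at hg
  rw [toFactorCategory_map_eq_zero_iff k hfin hT]
  exact fun t => hf _ (by rw [Category.assoc, hg])

lemma epi_toFactorCategory_map (D : SerreDuality k C)
    (hfin : ∀ X Y : C, Module.Finite k (X ⟶ Y)) {T : C}
    (hT : IsRigidObject T) {X Y : C} (f : X ⟶ Y)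
    (hf : ∀ s : Y ⟶ D.ν.functor.obj T, f ≫ s = 0 → s = 0) :
    Epi ((toFactorCategory T).map f) := by
  refine Preadditive.epi_of_cancel_zero _ fun {W} g hg => ?_
  obtain ⟨W⟩ := W
  obtain ⟨g, rfl⟩ := (toFactorCategory T).map_surjective g
  rw [← Functor.map_comp, toFactorCategory_map_eq_zero_iff' D hfin hT] at hg
  rw [toFactorCategory_map_eq_zero_iff' D hfin hT]
  exact fun s => hf _ (by rw [← Category.assoc, hg])

/-- No nonzero map out of `T` dies in the quotient: test it on `𝟙 T`. -/
lemma eq_zero_of_mono_toFactorCategory_map (hfin : ∀ X Y : C, Module.Finite k (X ⟶ Y)) {T : C}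
    (hT : IsRigidObject T) {X Y : C} (f : X ⟶ Y) [Mono ((toFactorCategory T).map f)]
    (t : T ⟶ X) (ht : t ≫ f = 0) : t = 0 := by
  have h : (toFactorCategory T).map t = 0 := by
    rw [← cancel_mono ((toFactorCategory T).map f), ← Functor.map_comp, ht, Functor.map_zero,
      zero_comp]
  simpa using (toFactorCategory_map_eq_zero_iff k hfin hT t).1 h (𝟙 T)

lemma eq_zero_of_epi_toFactorCategory_map (D : SerreDuality k C)
    (hfin : ∀ X Y : C, Module.Finite k (X ⟶ Y)) {T : C}
    (hT : IsRigidObject T) {X Y : C} (f : X ⟶ Y) [Epi ((toFactorCategory T).map f)]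
    (s : Y ⟶ D.ν.functor.obj T) (hs : f ≫ s = 0) : s = 0 := by
  have h : (toFactorCategory T).map s = 0 := by
    rw [← cancel_epi ((toFactorCategory T).map f), ← Functor.map_comp, hs, Functor.map_zero,
      comp_zero]
  simpa using (toFactorCategory_map_eq_zero_iff' D hfin hT s).1 h (𝟙 _)

/-- A morphism of `C` inducing a kernel of `f` in `C / X_T`, with the property that the morphisms
to `ν T` which it annihilates factor through `f`. -/
lemma exists_kernel_representative (D : SerreDuality k C)
    (hfin : ∀ X Y : C, Module.Finite k (X ⟶ Y)) {T : C} (hT : IsRigidObject T)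
    {X Y : C} (f : X ⟶ Y) :
    ∃ (K : C) (i : K ⟶ X), Mono ((toFactorCategory T).map i) ∧
      (toFactorCategory T).map (i ≫ f) = 0 ∧
      (∀ {W : C} (w : W ⟶ X), (toFactorCategory T).map (w ≫ f) = 0 → ∃ l, l ≫ i = w) ∧
      ∀ g : X ⟶ D.ν.functor.obj T, i ≫ g = 0 → ∃ e, f ≫ e = g := by
  obtain ⟨n, j, hj⟩ := exists_left_approximation k (D.ν.functor.obj T) Y
  -- Composing with `j` leaves the same maps killed in the quotient, and makes the cone of `i` a
  -- power of `νT`, which forces `i` to become mono.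
  obtain ⟨K, i, r, hd⟩ := distinguished_cocone_triangle₁ (f ≫ j)
  have hi : i ≫ f ≫ j = 0 := distTriang_comp_eq_zero hd
  refine ⟨K, i, mono_toFactorCategory_map hfin hT i
    (D.eq_zero_of_isRigidObject_of_comp hT hd), ?_, fun w hw => ?_, fun g hg => ?_⟩
  · rw [toFactorCategory_map_eq_zero_iff' D hfin hT]
    intro s
    obtain ⟨s', rfl⟩ := hj s
    rw [← Category.assoc, Category.assoc i, hi, zero_comp]
  · rw [toFactorCategory_map_eq_zero_iff' D hfin hT] at hw
    obtain ⟨l, hl⟩ := distTriang_exists_comp_mor₁ hd w (by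
      apply biproduct.hom_ext
      intro a
      rw [zero_comp]
      simpa using hw (j ≫ biproduct.π _ a))
    exact ⟨l, hl.symm⟩
  · obtain ⟨e, he⟩ := distTriang_exists_mor₂_comp hd g hg
    exact ⟨j ≫ e, by rw [he, Category.assoc]⟩

/-- A morphism of `C` inducing a cokernel of `f` in `C / X_T`, with the property that the morphisms
from `T` which it annihilates factor through `f`. -/
lemma exists_cokernel_representative (D : SerreDuality k C)
    (hfin : ∀ X Y : C, Module.Finite k (X ⟶ Y)) {T : C} (hT : IsRigidObject T)
    {X Y : C} (f : X ⟶ Y) :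
    ∃ (Q : C) (q : Y ⟶ Q), Epi ((toFactorCategory T).map q) ∧
      (toFactorCategory T).map (f ≫ q) = 0 ∧
      (∀ {W : C} (w : Y ⟶ W), (toFactorCategory T).map (f ≫ w) = 0 → ∃ l, q ≫ l = w) ∧
      ∀ g : T ⟶ Y, g ≫ q = 0 → ∃ e, e ≫ f = g := by
  obtain ⟨n, p, hp⟩ := exists_right_approximation k T X
  obtain ⟨Q, q, r, hd⟩ := distinguished_cocone_triangle (p ≫ f)
  have hq : (p ≫ f) ≫ q = 0 := distTriang_comp_eq_zero hd
  refine ⟨Q, q, epi_toFactorCategory_map D hfin hT q fun s hs => ?_, ?_, fun w hw => ?_,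
    fun g hg => ?_⟩
  · obtain ⟨g, hg⟩ := distTriang_exists_mor₃_comp hd s hs
    have hg0 : g = 0 := by
      let e := (shiftFunctor C (1 : ℤ)).mapBiproduct (fun _ : Fin n => T)
      rw [← cancel_epi e.inv, comp_zero]
      apply biproduct.hom_ext'
      intro i
      rw [comp_zero]
      exact D.eq_zero_of_forall_eq_zero T hT _
    rw [hg, hg0, comp_zero]
  · rw [toFactorCategory_map_eq_zero_iff k hfin hT]
    intro t
    obtain ⟨t', rfl⟩ := hp t
    rw [← Category.assoc, Category.assoc t', Category.assoc t', hq, comp_zero]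
  · rw [toFactorCategory_map_eq_zero_iff k hfin hT] at hw
    obtain ⟨l, hl⟩ := distTriang_exists_mor₂_comp hd w (by
      apply biproduct.hom_ext'
      intro a
      rw [comp_zero]
      simpa using hw (biproduct.ι (fun _ => T) a ≫ p))
    exact ⟨l, hl.symm⟩
  · obtain ⟨e, he⟩ := distTriang_exists_comp_mor₁ hd g hg
    exact ⟨e ≫ p, by rw [he, Category.assoc]⟩

/-- The projection is additive and every object is in its image, so biproducts descend from `C`. -/
lemma hasFiniteBiproducts_factorCategory (T : C) : HasFiniteBiproducts (FactorCategory T) where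
  out _ :=
    { has_biproduct := fun F =>
        inferInstanceAs (HasBiproduct fun i => (toFactorCategory T).obj (F i).as) }

lemma isPreabelian_factorCategory (D : SerreDuality k C)
    (hfin : ∀ X Y : C, Module.Finite k (X ⟶ Y)) {T : C} (hT : IsRigidObject T) :
    IsPreabelian (FactorCategory T) where
  hasFiniteBiproducts := hasFiniteBiproducts_factorCategory T
  hasKernels := ⟨by
    rintro ⟨X⟩ ⟨Y⟩ f
    obtain ⟨f, rfl⟩ := (toFactorCategory T).map_surjective f
    obtain ⟨K, i, hi, hif, hl, -⟩ := exists_kernel_representative D hfin hT f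
    rw [Functor.map_comp] at hif
    refine ⟨⟨_, KernelFork.IsLimit.ofι' ((toFactorCategory T).map i) hif fun {W} w hw => ?_⟩⟩
    -- The lift is required as data, but is only known to exist; its uniqueness comes from `hi`.
    apply Classical.choice
    obtain ⟨W⟩ := W
    obtain ⟨w, rfl⟩ := (toFactorCategory T).map_surjective w
    rw [← Functor.map_comp] at hw
    obtain ⟨l, rfl⟩ := hl w hw
    exact ⟨(toFactorCategory T).map l, (Functor.map_comp _ _ _).symm⟩⟩
  hasCokernels := ⟨by
    rintro ⟨X⟩ ⟨Y⟩ f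
    obtain ⟨f, rfl⟩ := (toFactorCategory T).map_surjective f
    obtain ⟨Q, q, hq, hfq, hl, -⟩ := exists_cokernel_representative D hfin hT f
    rw [Functor.map_comp] at hfq
    refine ⟨⟨_, CokernelCofork.IsColimit.ofπ' ((toFactorCategory T).map q) hfq
      fun {W} w hw => ?_⟩⟩
    apply Classical.choice
    obtain ⟨W⟩ := W
    obtain ⟨w, rfl⟩ := (toFactorCategory T).map_surjective w
    rw [← Functor.map_comp] at hw
    obtain ⟨l, rfl⟩ := hl w hw
    exact ⟨(toFactorCategory T).map l, (Functor.map_comp _ _ _).symm⟩⟩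

lemma pullbacksPreserveEpi_factorCategory (D : SerreDuality k C)
    (hfin : ∀ X Y : C, Module.Finite k (X ⟶ Y)) {T : C} (hT : IsRigidObject T) :
    PullbacksPreserveEpi (FactorCategory T) := by
  rintro ⟨P⟩ ⟨B⟩ ⟨X⟩ ⟨Z⟩ a b c d h hd
  obtain ⟨c, rfl⟩ := (toFactorCategory T).map_surjective c
  obtain ⟨d, rfl⟩ := (toFactorCategory T).map_surjective d
  obtain ⟨K, i, -, hi, -, hg⟩ := exists_kernel_representative D hfin hT (biprod.desc c (-d))
  have comm : (toFactorCategory T).map (i ≫ biprod.fst) ≫ (toFactorCategory T).map c =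
      (toFactorCategory T).map (i ≫ biprod.snd) ≫ (toFactorCategory T).map d := by
    rw [← sub_eq_zero, ← Functor.map_comp, ← Functor.map_comp, ← Functor.map_sub, ← hi]
    congr 1
    simp [biprod.desc_eq, sub_eq_add_neg]
  have : Epi ((toFactorCategory T).map (i ≫ biprod.fst)) := by
    refine epi_toFactorCategory_map D hfin hT _ fun s hs => ?_
    -- Extended by zero on `X`, `s` factors through `(c, -d)`; the resulting `e` is killed by `d`,
    -- hence zero.
    obtain ⟨e, he⟩ := hg (biprod.fst ≫ s) (by rw [← Category.assoc, hs])
    have h₁ : c ≫ e = s := by simpa using biprod.inl ≫= he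
    have h₂ : d ≫ e = 0 := by simpa using biprod.inr ≫= he
    rw [← h₁, eq_zero_of_epi_toFactorCategory_map D hfin hT d e h₂, comp_zero]
  -- The epimorphism from `K` factors through `a` by the comparison map to the pullback.
  exact epi_of_epi_fac (h.lift_fst _ _ comm)

lemma pushoutsPreserveMono_factorCategory (D : SerreDuality k C)
    (hfin : ∀ X Y : C, Module.Finite k (X ⟶ Y)) {T : C} (hT : IsRigidObject T) :
    PushoutsPreserveMono (FactorCategory T) := by
  rintro ⟨P⟩ ⟨B⟩ ⟨X⟩ ⟨Z⟩ a b c d h ha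
  obtain ⟨a, rfl⟩ := (toFactorCategory T).map_surjective a
  obtain ⟨b, rfl⟩ := (toFactorCategory T).map_surjective b
  obtain ⟨Q, q, -, hq, -, hg⟩ := exists_cokernel_representative D hfin hT (biprod.lift a (-b))
  have comm : (toFactorCategory T).map a ≫ (toFactorCategory T).map (biprod.inl ≫ q) =
      (toFactorCategory T).map b ≫ (toFactorCategory T).map (biprod.inr ≫ q) := by
    rw [← sub_eq_zero, ← Functor.map_comp, ← Functor.map_comp, ← Functor.map_sub, ← hq]
    congr 1
    simp [biprod.lift_eq, sub_eq_add_neg]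
  have : Mono ((toFactorCategory T).map (biprod.inr ≫ q)) := by
    refine mono_toFactorCategory_map hfin hT _ fun t ht => ?_
    -- Dually, `(0, t)` factors through `(a, -b)` by some `e` with `e ≫ a = 0`, so `e = 0`.
    obtain ⟨e, he⟩ := hg (t ≫ biprod.inr) (by rw [Category.assoc, ht])
    have h₁ : e ≫ a = 0 := by simpa using he =≫ biprod.fst
    have h₂ : -(e ≫ b) = t := by simpa using he =≫ biprod.snd
    rw [← h₂, eq_zero_of_mono_toFactorCategory_map hfin hT a e h₁, zero_comp, neg_zero]
  exact mono_of_mono_fac (h.inr_desc _ _ comm)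

end RigidQuotient

theorem corollary3p9 {k : Type w} [Field k] {C : Type u} [Category.{v} C] [EssentiallySmall.{v} C]
    [Preadditive C] [Linear k C] [HasZeroObject C] [HasShift C ℤ]
    [∀ n : ℤ, (shiftFunctor C n).Additive] [∀ n : ℤ, (shiftFunctor C n).Linear k]
    [Pretriangulated C] [IsTriangulated C]
    (hHomFinite : ∀ X Y : C, Module.Finite k (X ⟶ Y))
    (hKrullSchmidt : IsKrullSchmidt C)
    (hSerre : Nonempty (SerreDuality k C))
    (T : C) (hT : IsRigidObject T) :
    IsIntegralCategory (FactorCategory T) := by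
  obtain ⟨D⟩ := hSerre
  exact ⟨isPreabelian_factorCategory D hHomFinite hT,
    pullbacksPreserveEpi_factorCategory D hHomFinite hT,
    pushoutsPreserveMono_factorCategory D hHomFinite hT⟩
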